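/- Let $k$ be a field and let $X \to \operatorname{Spec} k$ be a regular, connected, proper curve over $k$, that is, a proper morphism whose source $X$ is a connected scheme of Krull dimension $1$ all of whose local rings are regular (such an $X$ is automatically integral and Noetherian). Let $F$ be the field of rational functions on $X$, i.e. the local ring of $X$ at its generic point. Let $|X|^1$ be the set of points of $X$ of codimension $1$; for $p \in |X|^1$ let $k(p)$ be the residue field of $p$ and $v_p : F^\times \to \mathbb{Z}$ the normalized valuation of the discrete valuation ring $\mathcal{O}_{X,p}$. Then for every $f \in F^{\times}$ the field $k(p)$ is a finite extension of $k$ for all $p \in |X|^1$, $v_p(f) \neq 0$ for only finitely many $p \in |X|^1$, and $$\sum_{p \in |X|^1} [k(p):k]\cdot v_p(f) = 0.$$ -/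

import Mathlib

open CategoryTheory AlgebraicGeometry TopologicalSpace

universe u

/-- A regular scheme: locally Noetherian, with all local rings regular. -/
class IsRegularScheme (X : Scheme.{u}) : Prop extends IsLocallyNoetherian X where
  isRegularLocalRing_stalk (x : X) : IsRegularLocalRing (X.presheaf.stalk x)

/-- The ring homomorphism from `k` to the residue field `k(p)` of a point `p` of a `k`-scheme,
i.e. the one whose `Spec` is the composition `Spec k(p) ⟶ X ⟶ Spec k`. -/
noncomputable def residueFieldHom {k : Type u} [Field k] {X : Scheme.{u}}
    (π : X ⟶ Spec (CommRingCat.of k)) (p : X) : k →+* X.residueField p :=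
  (Spec.preimage (X.fromSpecResidueField p ≫ π)).hom

/-- The degree `[k(p) : k]` of a point `p` of a `k`-scheme. -/
noncomputable def pointDegree {k : Type u} [Field k] {X : Scheme.{u}}
    (π : X ⟶ Spec (CommRingCat.of k)) (p : X) : ℕ :=
  letI := (residueFieldHom π p).toAlgebra
  Module.finrank k (X.residueField p)

/-- A regular local ring of dimension at most one is a domain. -/
theorem isDomain_of_isRegularLocalRing_of_dim_le_one (R : Type u) [CommRing R]
    [IsRegularLocalRing R] (h : ringKrullDim R ≤ 1) : IsDomain R := by
  have hfr : (IsLocalRing.maximalIdeal R).spanFinrank ≤ 1 := by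
    rw [← IsRegularLocalRing.spanFinrank_maximalIdeal] at h
    exact_mod_cast h
  obtain ⟨x, hx⟩ : ∃ x, IsLocalRing.maximalIdeal R = Ideal.span {x} := by
    have hfg : (IsLocalRing.maximalIdeal R).FG :=
      (isNoetherianRing_iff_ideal_fg R).mp inferInstance _
    have h1 := Submodule.FG.generators_ncard hfg
    have h2 := Submodule.span_generators (IsLocalRing.maximalIdeal R)
    have hfin := Submodule.FG.finite_generators hfg
    rw [← h1] at hfr
    rcases (Set.ncard_le_one_iff_eq hfin).mp hfr with h0 | ⟨a, ha⟩
    · exact ⟨0, by rw [← h2, h0]; exact Submodule.span_empty.trans (by simp)⟩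
    · exact ⟨a, by rw [← h2, ha]⟩
  obtain ⟨P, hP, hPm⟩ := Ideal.exists_minimalPrimes_le
    (bot_le : (⊥ : Ideal R) ≤ IsLocalRing.maximalIdeal R)
  have hPp : P.IsPrime := hP.1.1
  suffices hb : P = ⊥ by
    rw [hb] at hPp
    exact IsDomain.of_bot_isPrime R
  by_cases hxP : x ∈ P
  · have hPm' : P = IsLocalRing.maximalIdeal R :=
      le_antisymm hPm (by rw [hx, Ideal.span_singleton_le_iff_mem]; exact hxP)
    have hd : ringKrullDim R = 0 := by
      rw [← IsLocalRing.maximalIdeal_height_eq_ringKrullDim, ← hPm',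
        Ideal.height_eq_zero_iff.mpr hP]
      rfl
    have h0 : (IsLocalRing.maximalIdeal R).spanFinrank = 0 := by
      have := IsRegularLocalRing.spanFinrank_maximalIdeal (R := R)
      rw [hd] at this
      exact_mod_cast this
    rw [hPm']
    exact (Submodule.spanFinrank_eq_zero_iff_eq_bot
      ((isNoetherianRing_iff_ideal_fg R).mp inferInstance _)).mp h0
  · refine Submodule.eq_bot_of_le_smul_of_le_jacobson_bot (Ideal.span {x}) P
      ((isNoetherianRing_iff_ideal_fg R).mp inferInstance _) ?_ ?_
    · intro y hy
      have hym : y ∈ Ideal.span {x} := hx ▸ hPm hy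
      obtain ⟨a, rfl⟩ := Ideal.mem_span_singleton'.mp hym
      have ha : a ∈ P := (hPp.mem_or_mem hy).resolve_right hxP
      rw [mul_comm]
      exact Submodule.smul_mem_smul (Ideal.mem_span_singleton_self x) ha
    · rw [← hx, IsLocalRing.jacobson_eq_maximalIdeal _ bot_ne_top]

/-- The dimension of a local ring of a scheme is at most the dimension of the scheme. -/
theorem ringKrullDim_stalk_le_topologicalKrullDim {X : Scheme.{u}} (x : X) :
    ringKrullDim (X.presheaf.stalk x) ≤ topologicalKrullDim X := by
  rw [ringKrullDim_stalk_eq_coheight]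
  exact (Order.coheight_le_krullDim x).trans
    (Order.krullDim_eq_of_orderIso (irreducibleSetEquivPoints (α := X))).ge

/-- A point of a scheme whose local ring is a domain lies on only one irreducible component. -/
theorem irreducibleComponents_unique_of_isDomain_stalk {X : Scheme.{u}} (x : X)
    [IsDomain (X.presheaf.stalk x)] {Z W : Set X} (hZ : Z ∈ irreducibleComponents X)
    (hW : W ∈ irreducibleComponents X) (hxZ : x ∈ Z) (hxW : x ∈ W) : Z = W := by
  have key : ∀ Y ∈ irreducibleComponents X, x ∈ Y →
      Y = closure {X.fromSpecStalk x (⊥ : PrimeSpectrum (X.presheaf.stalk x))} := by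
    intro Y hY hxY
    have hYc := isClosed_of_mem_irreducibleComponents Y hY
    obtain ⟨g, hg⟩ := QuasiSober.sober hY.1 hYc
    have hgx : g ⤳ x := specializes_iff_mem_closure.mpr (hg.def ▸ hxY)
    rw [← Set.mem_ofPred_eq (p := fun y => y ⤳ x), ← X.range_fromSpecStalk] at hgx
    obtain ⟨q, rfl⟩ := hgx
    have hq : (⊥ : PrimeSpectrum (X.presheaf.stalk x)) ⤳ q :=
      (PrimeSpectrum.le_iff_specializes _ _).mp bot_le
    have h1 := (hq.map (X.fromSpecStalk x).continuous).closure_subset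
    rw [hg.def] at h1
    exact le_antisymm h1 (hY.2 isIrreducible_singleton.closure h1)
  rw [key Z hZ hxZ, key W hW hxW]

/-- A regular connected proper curve over a field is an integral scheme. -/
theorem isIntegral_of_isRegularScheme_curve {k : Type u} [Field k] {X : Scheme.{u}}
    (π : X ⟶ Spec (CommRingCat.of k)) [IsProper π] [IsRegularScheme X] [ConnectedSpace X]
    (hX : topologicalKrullDim X = 1) : IsIntegral X := by
  have hdom (x : X) : IsDomain (X.presheaf.stalk x) :=
    haveI := IsRegularScheme.isRegularLocalRing_stalk x
    isDomain_of_isRegularLocalRing_of_dim_le_one _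
      ((ringKrullDim_stalk_le_topologicalKrullDim x).trans hX.le)
  have : CompactSpace X := QuasiCompact.compactSpace_of_compactSpace π
  have : IsNoetherian X := { }
  have hfin := TopologicalSpace.NoetherianSpace.finite_irreducibleComponents (α := X)
  have : IsReduced X := isReduced_of_isReduced_stalk X
  let Z := irreducibleComponent (Classical.arbitrary X)
  have hZ : Z ∈ irreducibleComponents X := irreducibleComponent_mem_irreducibleComponents _
  have hopen : IsOpen Z := by
    have : Zᶜ = ⋃₀ (irreducibleComponents X \ {Z}) := by
      ext y
      constructor
      · intro hy
        refine ⟨irreducibleComponent y, ⟨irreducibleComponent_mem_irreducibleComponents y, ?_⟩,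
          mem_irreducibleComponent⟩
        intro h
        exact hy ((show irreducibleComponent y = Z from h) ▸ mem_irreducibleComponent)
      · rintro ⟨W, ⟨hW, hne⟩, hyW⟩ hyZ
        exact hne (irreducibleComponents_unique_of_isDomain_stalk y hW hZ hyW hyZ)
    rw [← isClosed_compl_iff, this, Set.sUnion_eq_biUnion]
    exact (hfin.subset Set.sdiff_subset).isClosed_biUnion
      fun W hW => isClosed_of_mem_irreducibleComponents W hW.1
  have huniv : Z = Set.univ :=
    IsClopen.eq_univ ⟨isClosed_of_mem_irreducibleComponents Z hZ, hopen⟩ hZ.1.1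
  have : IrreducibleSpace X := by
    have h1 : IsIrreducible (Set.univ : Set X) := huniv ▸ hZ.1
    exact (irreducibleSpace_def X).mpr h1
  exact isIntegral_of_irreducibleSpace_of_isReduced X

/-! The order of `f` at a point is minus the logarithm of a discrete valuation of `F`, so the sum
vanishes exactly when the zeros and the poles of `f` have the same degree. If `f` is integral over
`k`, it has neither. Otherwise it suffices to show that the degree of the zeros is at most that of
the poles, and to apply this to `f` and to `f⁻¹`.

The two degrees are compared through families independent over `k[f]`. Weak approximation produces
such a family whose size is the degree of the zeros (`exists_independent_of_zeros`). Conversely, if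
`n` elements `u j` are independent over `k[f]`, the `l * n` products `f ^ i * u j` with `i < l` are
independent over `k` and lie in a Riemann–Roch space of dimension at most `l` times the degree of
the poles plus a constant. Letting `l` grow bounds `n` by that degree
(`card_le_divDegree_poleDivisor`).

The argument needs three facts about the places. Each nonzero function has finitely many zeros and
poles; a function without poles is integral over `k`, because `π` is universally closed; and no
local ring of a place contains that of another, by the valuative criterion of separatedness. -/

open WithZero

/-! ### Discrete places and leading coefficients -/

/-- A discrete place of `F` over `k`: a normalized `ℤ`-valued valuation of `F`, written
multiplicatively, which is bounded on `k`. -/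
structure DiscretePlace (k F : Type*) [Field k] [Field F] [Algebra k F] where
  /-- The underlying valuation. -/
  v : Valuation F (WithZero (Multiplicative ℤ))
  map_algebraMap_le_one (c : k) : v (algebraMap k F c) ≤ 1
  exists_uniformizer : ∃ ϖ : F, v ϖ = exp (-1)

namespace DiscretePlace

section Place

variable {k F : Type*} [Field k] [Field F] [Algebra k F]

/-- The elements with a pole of order at most `n` at the place `P`. -/
def ball (P : DiscretePlace k F) (n : ℤ) : Submodule k F where
  carrier := {x | P.v x ≤ exp n}
  zero_mem' := by simp
  add_mem' ha hb := (P.v.map_add _ _).trans (max_le ha hb)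
  smul_mem' c x hx := by
    simp only [Set.mem_ofPred_eq, Algebra.smul_def, map_mul] at hx ⊢
    exact (mul_le_of_le_one_left zero_le (P.map_algebraMap_le_one c)).trans hx

@[simp]
theorem mem_ball {P : DiscretePlace k F} {n : ℤ} {x : F} : x ∈ P.ball n ↔ P.v x ≤ exp n :=
  Iff.rfl

/-- The residue field of a place, as a vector space. -/
abbrev ResidueSpace (P : DiscretePlace k F) : Type _ :=
  P.ball 0 ⧸ (P.ball (-1)).submoduleOf (P.ball 0)

/-- The degree of a place. -/
noncomputable def degree (P : DiscretePlace k F) : ℕ := Module.finrank k P.ResidueSpace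

/-- The leading coefficient of an element with a pole of order at most `n`. -/
theorem exists_leadingCoeff (P : DiscretePlace k F) (n : ℤ) :
    ∃ ψ : P.ball n →ₗ[k] P.ResidueSpace, Function.Surjective ψ ∧
      ∀ x, ψ x = 0 ↔ P.v x ≤ exp (n - 1) := by
  obtain ⟨ϖ, hϖ⟩ := P.exists_uniformizer
  have hϖ0 : ϖ ≠ 0 := by
    rintro rfl
    exact exp_ne_zero (hϖ.symm.trans P.v.map_zero)
  have hpow (m : ℤ) : P.v (ϖ ^ m) = exp (-m) := by
    rw [map_zpow₀, hϖ, ← exp_zsmul]; simp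
  -- Multiplication by `ϖ ^ n` lowers pole orders by `n`, which reduces the claim to the residue map
  -- on `P.ball 0`.
  let μ : P.ball n →ₗ[k] P.ball 0 :=
    ((LinearMap.mulLeft k (ϖ ^ n)).comp (P.ball n).subtype).codRestrict (P.ball 0) fun x => by
      have hx : P.v x ≤ exp n := x.2
      simp only [LinearMap.comp_apply, Submodule.subtype_apply, LinearMap.mulLeft_apply, mem_ball,
        map_mul, hpow]
      calc exp (-n) * P.v x ≤ exp (-n) * exp n := by gcongr
        _ = exp 0 := by rw [← exp_add]; simp
  refine ⟨(Submodule.mkQ _).comp μ, ?_, fun x => ?_⟩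
  · refine (Submodule.mkQ_surjective _).comp fun y => ?_
    have hy : P.v y ≤ exp 0 := y.2
    refine ⟨⟨ϖ ^ (-n) * y, ?_⟩, ?_⟩
    · simp only [mem_ball, map_mul, hpow, neg_neg]
      calc exp n * P.v y ≤ exp n * exp 0 := by gcongr
        _ = exp n := by rw [← exp_add]; simp
    · ext
      change ϖ ^ n * (ϖ ^ (-n) * (y : F)) = y
      rw [← mul_assoc, ← zpow_add₀ hϖ0, add_neg_cancel, zpow_zero, one_mul]
  · rw [LinearMap.comp_apply, Submodule.mkQ_apply, Submodule.Quotient.mk_eq_zero]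
    have h1 : (μ x : F) = ϖ ^ n * x := rfl
    rw [Submodule.submoduleOf, Submodule.mem_comap, Submodule.subtype_apply, h1, mem_ball, map_mul,
      hpow]
    constructor
    · intro h
      calc P.v x = exp n * (exp (-n) * P.v x) := by rw [← mul_assoc, ← exp_add]; simp
        _ ≤ exp n * exp (-1) := by gcongr
        _ = exp (n - 1) := by rw [← exp_add]; rfl
    · intro h
      calc exp (-n) * P.v x ≤ exp (-n) * exp (n - 1) := by gcongr
        _ = exp (-1) := by rw [← exp_add]; congr 1; ring

/-- The real absolute value attached to a place. -/
noncomputable def abv (P : DiscretePlace k F) : AbsoluteValue F ℝ where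
  -- Any base above `1` would do: only comparisons of absolute values are used.
  toFun x := WithZeroMulInt.toNNReal (e := 2) two_ne_zero (P.v x)
  map_mul' _ _ := by simp
  nonneg' _ := NNReal.zero_le_coe
  eq_zero' _ := by simp
  add_le' x y := by
    have hm := (WithZeroMulInt.toNNReal_strictMono (e := 2) one_lt_two).monotone
    have := (hm (P.v.map_add x y)).trans (hm.map_max.le.trans (max_le_add_of_nonneg bot_le bot_le))
    exact_mod_cast this

theorem abv_le_abv (P : DiscretePlace k F) {x y : F} : P.abv x ≤ P.abv y ↔ P.v x ≤ P.v y :=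
  NNReal.coe_le_coe.trans
    (WithZeroMulInt.toNNReal_strictMono (e := 2) one_lt_two).le_iff_le

theorem abv_lt_abv (P : DiscretePlace k F) {x y : F} : P.abv x < P.abv y ↔ P.v x < P.v y := by
  rw [← not_le, ← not_le, abv_le_abv]

theorem abv_isNontrivial (P : DiscretePlace k F) : P.abv.IsNontrivial := by
  obtain ⟨ϖ, hϖ⟩ := P.exists_uniformizer
  refine ⟨ϖ, by rintro rfl; exact exp_ne_zero (hϖ.symm.trans P.v.map_zero), ?_⟩
  rw [← map_one P.abv]
  refine ((P.abv_lt_abv).mpr ?_).ne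
  rw [hϖ, map_one, ← exp_zero, exp_lt_exp]
  simp

end Place

/-! ### Weak approximation and dimensions of Riemann–Roch spaces -/

section Family

variable {k F ι : Type*} [Field k] [Field F] [Algebra k F] (P : ι → DiscretePlace k F)

/-- Weak approximation: finitely many pairwise distinct places are independent. -/
theorem exists_approx [Finite ι] (hP : ∀ p q, p ≠ q → ∃ x, (P p).v x ≤ 1 ∧ ¬ (P q).v x ≤ 1)
    (p : ι) (N : ℕ) :
    ∃ e : F, (P p).v (e - 1) ≤ exp (-N : ℤ) ∧ ∀ q, q ≠ p → (P q).v e ≤ exp (-N : ℤ) := by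
  obtain ⟨y, hy1, hy⟩ := AbsoluteValue.exists_one_lt_lt_one_pi_of_not_isEquiv
    (v := fun i => (P i).abv) (fun i => (P i).abv_isNontrivial) (fun p q hpq h => by
      obtain ⟨x, hx, hx'⟩ := hP p q hpq
      have := h x 1
      rw [abv_le_abv, abv_le_abv, map_one, map_one] at this
      exact hx' (this.mp hx)) p
  have hlt (x : F) (Q : DiscretePlace k F) : Q.v x < 1 → Q.v x ≤ exp (-1) := fun h => by
    have h1 : (1 : WithZero (Multiplicative ℤ)) = exp (-1) * exp 1 := by rw [← exp_add]; rfl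
    rwa [h1, lt_mul_exp_iff_le exp_ne_zero] at h
  have hpow (x : F) (Q : DiscretePlace k F) (h : Q.v x < 1) : Q.v (x ^ N) ≤ exp (-N : ℤ) := by
    rw [map_pow]
    refine (pow_le_pow_left₀ zero_le (hlt x Q h) N).trans ?_
    rw [← exp_nsmul]; simp
  have hy1' : 1 < (P p).v y := by
    have := (P p).abv_lt_abv (x := 1) (y := y)
    rw [map_one, map_one] at this
    exact this.mp hy1
  have hy' (q) (hq : q ≠ p) : (P q).v y < 1 := by
    have := (P q).abv_lt_abv (x := y) (y := 1)
    rw [map_one, map_one] at this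
    exact this.mp (hy q hq)
  -- For `N = 0` the quotient used below would be `1 / 2`, which is no use in characteristic two.
  rcases Nat.eq_zero_or_pos N with rfl | hN
  · exact ⟨1, by simp, by simp⟩
  have hy0 : y ≠ 0 := by rintro rfl; simp at hy1'
  have hyp : 1 < (P p).v (y ^ N) := by rw [map_pow]; exact one_lt_pow₀ hy1' hN.ne'
  have hv : (P p).v (1 + y ^ N) = (P p).v (y ^ N) :=
    (P p).v.map_add_eq_of_lt_right (by rw [map_one]; exact hyp)
  have hne : 1 + y ^ N ≠ 0 := by
    intro h; rw [h, map_zero] at hv; rw [← hv] at hyp; simp at hyp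
  -- Since `y` is large at `p` and small elsewhere, this is close to `1` at `p` and to `0` at the
  -- other places.
  refine ⟨y ^ N / (1 + y ^ N), ?_, fun q hq => ?_⟩
  · have : y ^ N / (1 + y ^ N) - 1 = - (1 + y ^ N)⁻¹ := by field_simp; ring
    rw [this, Valuation.map_neg, map_inv₀, hv, ← map_inv₀, ← inv_pow]
    refine hpow _ _ ?_
    rw [map_inv₀]
    exact inv_lt_one_of_one_lt₀ hy1'
  · have h1 : (P q).v (y ^ N) < 1 := by rw [map_pow]; exact pow_lt_one₀ zero_le (hy' q hq) hN.ne'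
    have : (P q).v (1 + y ^ N) = 1 := by
      rw [← (P q).v.map_one]
      exact (P q).v.map_add_eq_of_lt_left (by simpa only [map_one] using h1)
    rw [map_div₀, this, div_one]
    exact hpow _ _ (hy' q hq)

/-- The Riemann–Roch space of a divisor. -/
def rrSpace (D : ι → ℤ) : Submodule k F where
  carrier := {x | ∀ p, x ∈ (P p).ball (D p)}
  zero_mem' _ := zero_mem _
  add_mem' ha hb p := add_mem (ha p) (hb p)
  smul_mem' c _ hx p := Submodule.smul_mem _ c (hx p)

variable {P} in
theorem rrSpace_mono {D D' : ι → ℤ} (h : D ≤ D') : rrSpace P D ≤ rrSpace P D' :=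
  fun _ hx p => (hx p).trans (exp_le_exp.mpr (h p))

/-- The degree of an effective divisor. -/
noncomputable def divDegree (E : ι →₀ ℕ) : ℕ := E.sum fun p n => (P p).degree * n

theorem divDegree_add (E E' : ι →₀ ℕ) :
    divDegree P (E + E') = divDegree P E + divDegree P E' :=
  Finsupp.sum_add_index' (by simp) (by intros; ring)

theorem divDegree_single (p : ι) (n : ℕ) :
    divDegree P (Finsupp.single p n) = (P p).degree * n :=
  Finsupp.sum_single_index (by simp)

theorem divDegree_smul (l : ℕ) (E : ι →₀ ℕ) : divDegree P (l • E) = l * divDegree P E := by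
  induction l with
  | zero => simp [divDegree]
  | succ l ih => rw [succ_nsmul, divDegree_add, ih]; ring

/-- Induction on effective divisors, one place at a time. -/
theorem divisor_induction {motive : (ι →₀ ℕ) → Prop} (zero : motive 0)
    (add : ∀ E E', motive E → motive E' → motive (E + E'))
    (single : ∀ p, motive (Finsupp.single p 1)) (E : ι →₀ ℕ) : motive E := by
  induction E using Finsupp.induction_linear with
  | zero => exact zero
  | add E E' h h' => exact add E E' h h'
  | single p n =>
    induction n with
    | zero => simpa using zero
    | succ n ih => rw [Finsupp.single_add]; exact add _ _ ih (single p)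

/-- The leading coefficient at `p` on a Riemann–Roch space. -/
theorem exists_rrSpace_leadingCoeff (D : ι → ℤ) (p : ι) :
    ∃ g : rrSpace P (fun q => D q + (Finsupp.single p 1 : ι →₀ ℕ) q) →ₗ[k] (P p).ResidueSpace,
      (∀ x, g x = 0 ↔ (x : F) ∈ rrSpace P D) ∧
      ([Finite ι] → (∀ p q, p ≠ q → ∃ x, (P p).v x ≤ 1 ∧ ¬ (P q).v x ≤ 1) →
        Function.Surjective g) := by
  obtain ⟨ψ, hψs, hψ⟩ := (P p).exists_leadingCoeff (D p + 1)
  have hle : rrSpace P (fun q => D q + (Finsupp.single p 1 : ι →₀ ℕ) q) ≤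
      (P p).ball (D p + 1) := fun x hx => by
    have := hx p
    simpa using this
  refine ⟨ψ.comp (Submodule.inclusion hle), fun x => ?_, fun hP y => ?_⟩
  · rw [LinearMap.comp_apply, hψ, Submodule.coe_inclusion, add_sub_cancel_right]
    refine ⟨fun h q => ?_, fun h => h p⟩
    by_cases hq : q = p
    · subst hq; exact h
    · have := x.2 q
      simpa [Finsupp.single_apply, Ne.symm hq] using this
  · obtain ⟨x, rfl⟩ := hψs y
    -- `N` bounds the excess of the poles of `x` over `D` at every place. Multiplying by `e` removes
    -- this excess away from `p`; the exponent `N + 1` also makes `e * x - x` of pole order at most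
    -- `D p` at `p`, so the leading coefficient there is kept.
    obtain ⟨N, hN⟩ := Finite.exists_le fun q => (log ((P q).v x) - D q).toNat
    obtain ⟨e, he1, he⟩ := exists_approx P hP p (N + 1)
    have hx : (P p).v x ≤ exp (D p + 1) := x.2
    have hd : (P p).v (e * x - x) ≤ exp (D p) := by
      rw [← sub_one_mul, map_mul]
      calc _ ≤ exp (-((N + 1 : ℕ) : ℤ)) * exp (D p + 1) := by gcongr
        _ = exp (-((N + 1 : ℕ) : ℤ) + (D p + 1)) := (exp_add _ _).symm
        _ ≤ exp (D p) := by rw [exp_le_exp]; push_cast; lia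
    have hz : e * (x : F) ∈ rrSpace P (fun q => D q + (Finsupp.single p 1 : ι →₀ ℕ) q) := by
      intro q
      by_cases hq : q = p
      · subst hq
        rw [show e * (x : F) = (e * x - x) + x by ring]
        refine add_mem ?_ ?_
        · exact hd.trans (exp_le_exp.mpr (by simp))
        · simp
      · simp only [mem_ball, map_mul]
        calc _ ≤ exp (-((N + 1 : ℕ) : ℤ)) * exp (log ((P q).v x)) := by
              gcongr
              · exact he q hq
              · exact le_exp_log
          _ = exp (-((N + 1 : ℕ) : ℤ) + log ((P q).v x)) := by rw [exp_add]
          _ ≤ _ := by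
            have := hN q
            rw [exp_le_exp]; push_cast; lia
    refine ⟨⟨_, hz⟩, ?_⟩
    rw [← sub_eq_zero, LinearMap.comp_apply, ← map_sub, hψ, add_sub_cancel_right]
    exact hd

/-- Allowing one more pole at `p` adds at most the dimension of the residue space, as the kernel of
the leading coefficient is the old space. -/
theorem finrank_rrSpace_add_le [∀ p, Module.Finite k (P p).ResidueSpace] (E : ι →₀ ℕ) :
    ∀ D : ι → ℤ, Module.Finite k (rrSpace P D) →
      Module.Finite k (rrSpace P fun q => D q + E q) ∧
      Module.finrank k (rrSpace P fun q => D q + E q) ≤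
        Module.finrank k (rrSpace P D) + divDegree P E := by
  induction E using divisor_induction with
  | zero =>
    intro D h
    have : (fun q => D q + ((0 : ι →₀ ℕ) q : ℕ)) = D := by ext; simp
    rw [this]
    exact ⟨h, Nat.le_add_right _ _⟩
  | add E E' h h' =>
    intro D hD
    obtain ⟨h1, h2⟩ := h D hD
    obtain ⟨h3, h4⟩ := h' _ h1
    have : (fun q => D q + ((E + E') q : ℕ)) = fun q => (D q + E q) + E' q := by
      ext q; push_cast [Finsupp.add_apply]; ring
    rw [this, divDegree_add]
    exact ⟨h3, by lia⟩
  | single p =>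
    intro D hD
    obtain ⟨g, hg, -⟩ := exists_rrSpace_leadingCoeff P D p
    have e : LinearMap.ker g ≃ₗ[k] rrSpace P D := by
      refine LinearEquiv.ofBijective (((Submodule.subtype _).comp
        (LinearMap.ker g).subtype).codRestrict (rrSpace P D) fun x => (hg _).mp x.2) ⟨?_, ?_⟩
      · intro x y h
        have h' := congrArg (fun z : rrSpace P D => (z : F)) h
        exact Subtype.ext (Subtype.ext h')
      · intro y
        exact ⟨⟨⟨y, rrSpace_mono (fun q => by simp) y.2⟩, (hg _).mpr y.2⟩, rfl⟩
    have : Module.Finite k (LinearMap.ker g) := Module.Finite.equiv e.symm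
    have : Module.Finite k (_ ⧸ LinearMap.ker g) :=
      Module.Finite.equiv g.quotKerEquivRange.symm
    have hfin : Module.Finite k
        (rrSpace P (fun q => D q + (Finsupp.single p 1 : ι →₀ ℕ) q)) :=
      Module.Finite.of_submodule_quotient (LinearMap.ker g)
    refine ⟨hfin, ?_⟩
    rw [← g.finrank_range_add_finrank_ker, e.finrank_eq, divDegree_single, mul_one, add_comm]
    gcongr
    exact Submodule.finrank_le _

/-- For finitely many places the leading coefficient is onto, so residue bases lift. Independence is
stated modulo `rrSpace P D`, which need not be finite-dimensional here. -/
theorem exists_linearIndependent_mod [Finite ι] [∀ p, Module.Finite k (P p).ResidueSpace]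
    (hP : ∀ p q, p ≠ q → ∃ x, (P p).v x ≤ 1 ∧ ¬ (P q).v x ≤ 1) (E : ι →₀ ℕ) :
    ∀ D : ι → ℤ, ∃ (J : Type) (_ : Fintype J) (u : J → F), Fintype.card J = divDegree P E ∧
      (∀ j, u j ∈ rrSpace P fun q => D q + E q) ∧
      ∀ c : J → k, ∑ j, c j • u j ∈ rrSpace P D → c = 0 := by
  induction E using divisor_induction with
  | zero =>
    exact fun D => ⟨Empty, inferInstance, Empty.elim, by simp [divDegree], by simp,
      fun c _ => Subsingleton.elim _ _⟩
  | add E E' h h' =>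
    intro D
    obtain ⟨J, _, u, hJ, hu, hi⟩ := h D
    obtain ⟨J', _, u', hJ', hu', hi'⟩ := h' fun q => D q + E q
    have hD : (fun q => D q + ((E + E') q : ℕ)) = fun q => (D q + E q) + E' q := by
      ext q; push_cast [Finsupp.add_apply]; ring
    refine ⟨J ⊕ J', inferInstance, Sum.elim u u', by simp [divDegree_add, hJ, hJ'], ?_, ?_⟩
    · rw [hD]
      rintro (j | j)
      · exact rrSpace_mono (fun q => by simp) (hu j)
      · exact hu' j
    · intro c hc
      simp only [Fintype.sum_sum_type, Sum.elim_inl, Sum.elim_inr] at hc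
      have h1 : ∑ j, c (Sum.inl j) • u j ∈ rrSpace P fun q => D q + E q :=
        sum_mem fun j _ => Submodule.smul_mem _ _ (hu j)
      have h2 := hi' (fun j => c (Sum.inr j))
        ((Submodule.add_mem_iff_right _ h1).mp (rrSpace_mono (fun q => by simp) hc))
      have h3 : ∀ j, c (Sum.inr j) = 0 := congrFun h2
      have h4 := hi (fun j => c (Sum.inl j)) (by simpa [h3] using hc)
      funext j
      rcases j with j | j
      · exact congrFun h4 j
      · exact h3 j
  | single p =>
    intro D
    obtain ⟨g, hg, hs⟩ := exists_rrSpace_leadingCoeff P D p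
    let b := Module.finBasis k (P p).ResidueSpace
    choose u hu using fun j => hs hP (b j)
    refine ⟨_, inferInstance, fun j => (u j : F), by simp [divDegree_single, degree],
      fun j => (u j).2, fun c hc => ?_⟩
    have h1 : g (∑ j, c j • u j) = 0 := (hg _).mpr (by simpa using hc)
    simp only [map_sum, map_smul, hu] at h1
    funext j
    exact Fintype.linearIndependent_iff.mp b.linearIndependent c h1 j

end Family

end DiscretePlace

namespace DiscretePlace

/-! ### Equality of the degrees of zeros and poles -/

section ProductFormula

open Polynomial

variable {k F ι : Type*} [Field k] [Field F] [Algebra k F] (P : ι → DiscretePlace k F)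

/-- A valuation ring is integrally closed, and this one contains the image of `k`. -/
theorem map_le_one_of_isIntegral (Q : DiscretePlace k F) {x : F} (hx : IsIntegral k x) :
    Q.v x ≤ 1 := by
  let A := Q.v.valuationSubring
  let φ : k →+* A := (algebraMap k F).codRestrict A.toSubring fun c => Q.map_algebraMap_le_one c
  obtain ⟨p, hp, hpx⟩ := hx
  have : IsIntegral A x := ⟨p.map φ, hp.map φ, by rw [eval₂_map]; exact hpx⟩
  obtain ⟨y, rfl⟩ := IsIntegrallyClosed.isIntegral_iff.mp this
  exact y.2

theorem map_eq_one_of_isIntegral (Q : DiscretePlace k F) {x : F} (hx : IsIntegral k x)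
    (h0 : x ≠ 0) : Q.v x = 1 := by
  refine le_antisymm (Q.map_le_one_of_isIntegral hx) ?_
  have h := Q.map_le_one_of_isIntegral hx.inv
  rw [map_inv₀] at h
  exact (inv_le_one₀ (by simpa [zero_lt_iff] using h0)).mp h

variable {P} (hfin : ∀ x : F, x ≠ 0 → {p | (P p).v x ≠ 1}.Finite)

/-- The divisor of poles of `x`. -/
noncomputable def poleDivisor (x : F) : ι →₀ ℕ :=
  Finsupp.ofSupportFinite (fun p => (log ((P p).v x)).toNat) <| by
    -- `log 0 = 0`, so the zero function gets the zero divisor.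
    by_cases hx : x = 0
    · simp [hx, Function.support]
    · refine (hfin x hx).subset fun p hp h => hp ?_
      simp [h]

theorem poleDivisor_apply (x : F) (p : ι) :
    poleDivisor hfin x p = (log ((P p).v x)).toNat := rfl

theorem map_le_exp_poleDivisor (x : F) (p : ι) :
    (P p).v x ≤ exp (poleDivisor hfin x p : ℤ) :=
  le_exp_log.trans (exp_le_exp.mpr (Int.self_le_toNat _))

variable (hint : ∀ x : F, (∀ p, (P p).v x ≤ 1) → IsIntegral k x)

-- A function without poles is integral over `k`, so if nonzero it is a unit at every place and
-- cannot vanish at `p`. This starts the dimension count at zero.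
include hint in
theorem rrSpace_neg_single_eq_bot (p : ι) :
    rrSpace P (fun q => -((Finsupp.single p 1 : ι →₀ ℕ) q : ℤ)) = ⊥ := by
  rw [eq_bot_iff]
  intro x hx
  rw [Submodule.mem_bot]
  by_contra h0
  have h1 := (P p).map_eq_one_of_isIntegral (hint x fun q => (hx q).trans ?_) h0
  · have := hx p
    rw [mem_ball, h1, ← exp_zero, exp_le_exp] at this
    simp at this
  · rw [← exp_zero, exp_le_exp]
    lia

-- Growth in `l` of the number of products `f ^ i * u j` with `i < l`, against the dimension of the
-- space containing them.
include hint in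
theorem card_le_divDegree_poleDivisor [∀ p, Module.Finite k (P p).ResidueSpace] {f : F}
    (hf : ¬ IsIntegral k f) {J : Type*} [Fintype J] (u : J → F)
    (hu : ∀ c : J → k[X], ∑ j, aeval f (c j) * u j = 0 → c = 0) :
    Fintype.card J ≤ divDegree P (poleDivisor hfin f) := by
  obtain ⟨p₀, -⟩ : ∃ p, ¬ (P p).v f ≤ 1 := by
    by_contra! h
    exact hf (hint f h)
  let C := ∑ j, poleDivisor hfin (u j)
  let δ : ι →₀ ℕ := Finsupp.single p₀ 1
  have hC (j : J) (p : ι) : (P p).v (u j) ≤ exp (C p : ℤ) := by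
    refine (map_le_exp_poleDivisor hfin (u j) p).trans (exp_le_exp.mpr ?_)
    simp only [C, Finsupp.coe_finsetSum, Finset.sum_apply]
    exact_mod_cast Finset.single_le_sum (f := fun j => poleDivisor hfin (u j) p)
      (fun _ _ => Nat.zero_le _) (Finset.mem_univ j)
  have key (l : ℕ) : l * Fintype.card J ≤
      l * divDegree P (poleDivisor hfin f) + (divDegree P C + divDegree P δ) := by
    -- The summand `δ` offsets the starting divisor `-δ`; `C` absorbs the poles of all `u j`.
    let E := l • poleDivisor hfin f + (C + δ)
    have hbot := rrSpace_neg_single_eq_bot (P := P) hint p₀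
    obtain ⟨h1, h2⟩ := finrank_rrSpace_add_le P E (fun q => -(δ q : ℤ))
      (by rw [hbot]; infer_instance)
    rw [hbot, finrank_bot, zero_add] at h2
    have hmem (a : Fin l × J) : f ^ (a.1 : ℕ) * u a.2 ∈ rrSpace P fun q => -(δ q : ℤ) + E q := by
      intro p
      rw [mem_ball, map_mul, map_pow]
      calc (P p).v f ^ (a.1 : ℕ) * (P p).v (u a.2)
          ≤ exp (poleDivisor hfin f p : ℤ) ^ (a.1 : ℕ) * exp (C p : ℤ) := by
            gcongr
            · exact map_le_exp_poleDivisor hfin f p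
            · exact hC _ _
        _ = exp ((a.1 : ℕ) • (poleDivisor hfin f p : ℤ) + C p) := by rw [exp_add, exp_nsmul]
        _ ≤ _ := by
            rw [exp_le_exp]
            simp only [E, Finsupp.add_apply, Finsupp.smul_apply, smul_eq_mul, nsmul_eq_mul]
            have : (a.1 : ℕ) * poleDivisor hfin f p ≤ l * poleDivisor hfin f p :=
              Nat.mul_le_mul_right _ a.1.2.le
            push_cast
            zify at this
            lia
    have hli : LinearIndependent k fun a : Fin l × J => f ^ (a.1 : ℕ) * u a.2 := by
      rw [Fintype.linearIndependent_iff]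
      intro c hc
      have h0 := hu (fun j => ∑ i : Fin l, monomial (i : ℕ) (c (i, j))) <| by
        rw [Fintype.sum_prod_type_right] at hc
        rw [← hc]
        refine Finset.sum_congr rfl fun j _ => ?_
        simp [Finset.sum_mul, aeval_monomial, Algebra.smul_def, mul_assoc]
      rintro ⟨i, j⟩
      have := congrArg (fun q => coeff q (i : ℕ)) (congrFun h0 j)
      simpa [coeff_monomial, Fin.val_inj] using this
    have hli' : LinearIndependent k fun a : Fin l × J =>
        (⟨_, hmem a⟩ : rrSpace P fun q => -(δ q : ℤ) + E q) :=
      LinearIndependent.of_comp (Submodule.subtype _) hli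
    have := hli'.fintype_card_le_finrank
    rw [Fintype.card_prod, Fintype.card_fin] at this
    refine (this.trans h2).trans_eq ?_
    rw [divDegree_add, divDegree_add, divDegree_smul]
  -- This `l` exceeds the constant term, so a cardinality larger by one is already contradictory.
  have := key (divDegree P C + divDegree P δ + 1)
  by_contra! h
  have := Nat.mul_le_mul_left (divDegree P C + divDegree P δ + 1) (Nat.succ_le_of_lt h)
  rw [Nat.succ_eq_add_one, mul_add] at this
  lia

/-- The `u j` are regular at the zeros of `f` and independent modulo functions vanishing there at
least as much as `f`. In a relation over `k[f]`, the constant terms give a multiple of `f`, hence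
vanish; dividing by `f` and repeating kills all coefficients. -/
theorem exists_independent_of_zeros [∀ p, Module.Finite k (P p).ResidueSpace]
    (hP : ∀ p q, p ≠ q → ∃ x, (P p).v x ≤ 1 ∧ ¬ (P q).v x ≤ 1) {f : F} (hf : f ≠ 0) :
    ∃ (J : Type) (_ : Fintype J) (u : J → F),
      Fintype.card J = divDegree P (poleDivisor hfin f⁻¹) ∧
      ∀ c : J → k[X], ∑ j, aeval f (c j) * u j = 0 → c = 0 := by
  classical
  let Z := {p | (P p).v f < 1}
  have : Finite Z := ((hfin f hf).subset fun p (hp : (P p).v f < 1) => hp.ne).to_subtype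
  let P' : Z → DiscretePlace k F := fun p => P p
  have (p : Z) : Module.Finite k (P' p).ResidueSpace := inferInstanceAs
    (Module.Finite k (P p).ResidueSpace)
  let E : ι →₀ ℕ := poleDivisor hfin f⁻¹
  -- Restricting to the finite set `Z`, where weak approximation applies, loses no degree.
  have hE : ∀ p ∈ E.support, p ∈ Z := by
    intro p hp
    rw [Finsupp.mem_support_iff, poleDivisor_apply, map_inv₀, log_inv] at hp
    by_contra h
    have h1 : 1 ≤ (P p).v f := not_lt.mp h
    rw [← exp_zero] at h1
    have := le_log_of_exp_le h1
    lia
  obtain ⟨J, _, u, hJ, hu, hi⟩ := exists_linearIndependent_mod P'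
    (fun p q hpq => hP p q (Subtype.coe_ne_coe.mpr hpq)) (E.subtypeDomain (· ∈ Z))
    (fun q => -(E q : ℤ))
  refine ⟨J, inferInstance, u, hJ.trans
    (Finsupp.sum_subtypeDomain_index (h := fun p n => (P p).degree * n) hE), ?_⟩
  have hu' (j : J) (p : Z) : (P p).v (u j) ≤ 1 := by
    have := hu j p
    simpa [P'] using this
  have hf' (p : Z) : (P p).v f ≤ exp (-(E p : ℤ)) := by
    refine le_exp_log.trans (exp_le_exp.mpr ?_)
    rw [poleDivisor_apply, map_inv₀, log_inv]
    have h0 : (P p).v f ≤ exp 0 := p.2.le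
    have := (log_le_iff_le_exp (by simpa using hf)).mpr h0
    lia
  have hf1 (q : k[X]) (p : Z) : (P p).v (aeval f q) ≤ 1 := by
    rw [aeval_eq_sum_range]
    refine (P p).v.map_sum_le fun i _ => ?_
    rw [Algebra.smul_def, map_mul, map_pow]
    exact mul_le_one₀ ((P p).map_algebraMap_le_one _) zero_le (pow_le_one₀ zero_le p.2.le)
  have key : ∀ (n : ℕ) (c : J → k[X]), ∑ j, aeval f (c j) * u j = 0 →
      ∀ j, (c j).coeff n = 0 := by
    intro n
    have hsplit (c : J → k[X]) : ∑ j, aeval f (c j) * u j =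
        f * ∑ j, aeval f (divX (c j)) * u j + ∑ j, (c j).coeff 0 • u j := by
      rw [Finset.mul_sum, ← Finset.sum_add_distrib]
      refine Finset.sum_congr rfl fun j _ => ?_
      conv_lhs => rw [← divX_mul_X_add (c j)]
      simp only [map_add, map_mul, aeval_X, aeval_C, Algebra.smul_def]
      ring
    have hzero (c : J → k[X]) (hc : ∑ j, aeval f (c j) * u j = 0) :
        (fun j => (c j).coeff 0) = 0 := by
      apply hi
      rw [hsplit] at hc
      rw [eq_neg_of_add_eq_zero_right hc]
      refine neg_mem fun p => ?_
      rw [mem_ball, map_mul]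
      refine (mul_le_of_le_one_right zero_le ?_).trans (hf' p)
      refine (P p).v.map_sum_le fun j _ => ?_
      rw [map_mul]
      exact mul_le_one₀ (hf1 _ p) zero_le (hu' j p)
    induction n with
    | zero => exact fun c hc j => congrFun (hzero c hc) j
    | succ n ih =>
      intro c hc j
      rw [← coeff_divX]
      refine ih (fun j => divX (c j)) ?_ j
      have h0 := hzero c hc
      rw [hsplit] at hc
      have h1 : ∑ j, (c j).coeff 0 • u j = 0 :=
        Finset.sum_eq_zero fun j _ => by rw [congrFun h0 j, Pi.zero_apply, zero_smul]
      rw [h1, add_zero] at hc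
      exact (mul_eq_zero.mp hc).resolve_left hf
  exact fun c hc => funext fun j => Polynomial.ext fun n => by
    simpa using key n c hc j

include hfin hint in
/-- The product formula for a system of places of a function field. -/
theorem finsum_degree_mul_log_eq_zero [∀ p, Module.Finite k (P p).ResidueSpace]
    (hP : ∀ p q, p ≠ q → ∃ x, (P p).v x ≤ 1 ∧ ¬ (P q).v x ≤ 1) {f : F} (hf : f ≠ 0) :
    ∑ᶠ p, ((P p).degree : ℤ) * log ((P p).v f) = 0 := by
  classical
  by_cases hf' : IsIntegral k f
  · simp [fun p => (P p).map_eq_one_of_isIntegral hf' hf]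
  have hle (g : F) (hg : g ≠ 0) (hg' : ¬ IsIntegral k g) :
      divDegree P (poleDivisor hfin g⁻¹) ≤ divDegree P (poleDivisor hfin g) := by
    obtain ⟨J, _, u, hJ, hu⟩ := exists_independent_of_zeros hfin hP hg
    rw [← hJ]
    exact card_le_divDegree_poleDivisor hfin hint hg' u hu
  have h1 := hle f hf hf'
  have h2 := hle f⁻¹ (inv_ne_zero hf) fun h => hf' (by simpa using h.inv)
  rw [inv_inv] at h2
  have heq := le_antisymm h1 h2
  let s := (poleDivisor hfin f⁻¹).support ∪ (poleDivisor hfin f).support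
  have hsum (E : ι →₀ ℕ) (hE : E.support ⊆ s) :
      (divDegree P E : ℤ) = ∑ p ∈ s, ((P p).degree : ℤ) * E p := by
    rw [divDegree, Finsupp.sum_of_support_subset _ hE _ (by simp)]
    push_cast
    rfl
  have hlog (p : ι) : log ((P p).v f) =
      (poleDivisor hfin f p : ℤ) - (poleDivisor hfin f⁻¹ p : ℤ) := by
    rw [poleDivisor_apply, poleDivisor_apply, map_inv₀, log_inv]
    lia
  rw [finsum_eq_sum_of_support_subset (s := s)]
  · simp only [hlog, mul_sub, Finset.sum_sub_distrib]
    rw [← hsum _ Finset.subset_union_left, ← hsum _ Finset.subset_union_right, heq, sub_self]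
  · intro p hp
    by_contra h
    apply hp
    simp only [s, Finset.coe_union, Set.mem_union, Finset.mem_coe, Finsupp.mem_support_iff,
      not_or, not_not] at h
    simp [hlog, h.1, h.2]

end ProductFormula

end DiscretePlace

namespace DiscretePlace

/-! ### The place of a discrete valuation ring -/

section DVR

variable (k R F : Type*) [Field k] [CommRing R] [IsDomain R] [IsDiscreteValuationRing R] [Field F]
  [Algebra k R] [Algebra k F] [Algebra R F] [IsScalarTower k R F] [IsFractionRing R F]

/-- The place attached to a discrete valuation ring. -/
noncomputable def ofDVR : DiscretePlace k F where
  v := (IsDiscreteValuationRing.maximalIdeal R).valuation F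
  map_algebraMap_le_one c := by
    rw [IsScalarTower.algebraMap_apply k R F]
    exact IsDedekindDomain.HeightOneSpectrum.valuation_le_one _ _
  exists_uniformizer := IsDedekindDomain.HeightOneSpectrum.valuation_exists_uniformizer F _

theorem ofDVR_v_le_one_iff {x : F} :
    (ofDVR k R F).v x ≤ 1 ↔ x ∈ (algebraMap R F).range := by
  constructor
  · exact IsDiscreteValuationRing.exists_lift_of_le_one
  · rintro ⟨a, rfl⟩
    exact IsDedekindDomain.HeightOneSpectrum.valuation_le_one _ _

/-- Both sides are quotients of `R` by its maximal ideal. -/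
theorem nonempty_residueField_equiv :
    Nonempty (IsLocalRing.ResidueField R ≃ₗ[k] (ofDVR k R F).ResidueSpace) := by
  let g : R →ₗ[k] (ofDVR k R F).ball 0 :=
    (IsScalarTower.toAlgHom k R F).toLinearMap.codRestrict _ fun a =>
      (ofDVR_v_le_one_iff k R F).mpr ⟨a, rfl⟩
  let h := (Submodule.mkQ ((((ofDVR k R F).ball (-1)).submoduleOf ((ofDVR k R F).ball 0)))).comp g
  have hs : Function.Surjective h := (Submodule.mkQ_surjective _).comp fun y => by
    obtain ⟨a, ha⟩ := (ofDVR_v_le_one_iff k R F).mp y.2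
    exact ⟨a, Subtype.ext ha⟩
  let r : R →ₗ[k] IsLocalRing.ResidueField R :=
    (IsScalarTower.toAlgHom k R (IsLocalRing.ResidueField R)).toLinearMap
  have hr : Function.Surjective r := IsLocalRing.residue_surjective
  have hker : LinearMap.ker r = LinearMap.ker h := by
    ext a
    rw [LinearMap.mem_ker, LinearMap.mem_ker, LinearMap.comp_apply, Submodule.mkQ_apply,
      Submodule.Quotient.mk_eq_zero]
    have h1 : r a = 0 ↔ a ∈ IsLocalRing.maximalIdeal R := IsLocalRing.residue_eq_zero_iff a
    have h2 : g a ∈ ((ofDVR k R F).ball (-1)).submoduleOf ((ofDVR k R F).ball 0) ↔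
      (ofDVR k R F).v (algebraMap R F a) ≤ exp (-1) := Iff.rfl
    have h3 : (1 : WithZero (Multiplicative ℤ)) = exp (-1) * exp 1 := by rw [← exp_add]; rfl
    rw [h1, h2, ← lt_mul_exp_iff_le exp_ne_zero, ← h3]
    exact (IsDedekindDomain.HeightOneSpectrum.valuation_lt_one_iff_mem
      (IsDiscreteValuationRing.maximalIdeal R) a).symm
  exact ⟨(r.quotKerEquivOfSurjective hr).symm ≪≫ₗ Submodule.quotEquivOfEq _ _ hker ≪≫ₗ
    h.quotKerEquivOfSurjective hs⟩

end DVR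

end DiscretePlace

/-- A regular local ring of dimension one is a discrete valuation ring. -/
theorem isDiscreteValuationRing_of_isRegularLocalRing (R : Type u) [CommRing R] [IsDomain R]
    [IsRegularLocalRing R] (h : ringKrullDim R = 1) : IsDiscreteValuationRing R := by
  have hr : (IsLocalRing.maximalIdeal R).spanFinrank = 1 := by
    have := IsRegularLocalRing.spanFinrank_maximalIdeal (R := R)
    rw [h] at this
    exact_mod_cast this
  have hfg : (IsLocalRing.maximalIdeal R).FG :=
    (isNoetherianRing_iff_ideal_fg R).mp inferInstance _
  have hfield : ¬ IsField R := by
    intro hR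
    rw [IsLocalRing.isField_iff_maximalIdeal_eq.mp hR] at hr
    simp at hr
  -- Item `4` is principality of the maximal ideal.
  refine ((IsDiscreteValuationRing.TFAE R hfield).out 0 4).mpr ?_
  obtain ⟨a, ha⟩ := Set.ncard_eq_one.mp ((Submodule.FG.generators_ncard hfg).trans hr)
  exact ⟨a, by rw [← Submodule.span_generators (IsLocalRing.maximalIdeal R), ha]⟩

/-! ### Points, local rings and global functions on the curve -/

section Curve

variable {k : Type u} [Field k] {X : Scheme.{u}} (π : X ⟶ Spec (CommRingCat.of k))

/-- The ring homomorphism from `k` to the local ring at a point of a `k`-scheme. -/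
noncomputable def stalkHom (p : X) : k →+* X.presheaf.stalk p :=
  (Spec.preimage (X.fromSpecStalk p ≫ π)).hom

theorem residueFieldHom_eq (p : X) :
    residueFieldHom π p = (IsLocalRing.residue (X.presheaf.stalk p)).comp (stalkHom π p) := by
  have : Spec.preimage (X.fromSpecResidueField p ≫ π) =
      Spec.preimage (X.fromSpecStalk p ≫ π) ≫ X.residue p := by
    apply Spec.map_injective
    rw [Spec.map_comp, Spec.map_preimage, Spec.map_preimage]
    rfl
  exact congrArg CommRingCat.Hom.hom this

theorem stalkSpecializes_comp_stalkHom {p q : X} (h : p ⤳ q) :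
    (X.presheaf.stalkSpecializes h).hom.comp (stalkHom π q) = stalkHom π p := by
  have : Spec.preimage (X.fromSpecStalk q ≫ π) ≫ X.presheaf.stalkSpecializes h =
      Spec.preimage (X.fromSpecStalk p ≫ π) := by
    apply Spec.map_injective
    rw [Spec.map_comp, Spec.map_preimage, Spec.map_preimage,
      Scheme.SpecMap_stalkSpecializes_fromSpecStalk_assoc]
  exact congrArg CommRingCat.Hom.hom this

/-- This is the Nullstellensatz: at a closed point the residue field is of finite type over `k`. -/
theorem residueFieldHom_finite_of_isClosed [LocallyOfFiniteType π] {p : X} (hp : IsClosed {p}) :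
    (residueFieldHom π p).Finite := by
  have : JacobsonSpace X := LocallyOfFiniteType.jacobsonSpace π
  have := isClosed_singleton_iff_locallyOfFiniteType.mp hp
  have : LocallyOfFiniteType (X.fromSpecResidueField p ≫ π) := inferInstance
  have h := isFinite_iff_locallyOfFiniteType_of_jacobsonSpace.mpr this
  rw [← Spec.map_preimage (X.fromSpecResidueField p ≫ π), IsFinite.SpecMap_iff] at h
  exact h

theorem isClosed_singleton_of_coheight_eq_one (hX : topologicalKrullDim X = 1) {p : X}
    (hp : Order.coheight p = 1) : IsClosed {p} := by
  have hdim : Order.krullDim X = 1 :=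
    (Order.krullDim_eq_of_orderIso (irreducibleSetEquivPoints (α := X))).symm.trans hX
  rw [← closure_eq_iff_isClosed]
  refine Set.Subset.antisymm (fun q hq => ?_) subset_closure
  have hle : q ≤ p := specializes_iff_mem_closure.mpr hq
  by_contra hne
  have hlt : q < p := lt_of_le_not_ge hle fun h =>
    hne (Specializes.antisymm (x := q) (y := p) h hle).eq
  have h1 : Order.coheight p + 1 ≤ Order.coheight q := Order.coheight_add_one_le hlt
  have h2 : ((Order.coheight q : ℕ∞) : WithBot ℕ∞) ≤ 1 :=
    (Order.coheight_le_krullDim q).trans hdim.le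
  have h3 : Order.coheight q ≤ 1 := by exact_mod_cast h2
  rw [hp] at h1
  exact absurd (h1.trans h3) (by decide)

/-- A nonempty open subset misses only finitely many points of codimension one. -/
theorem finite_setOf_coheight_eq_one_notMem [IsIntegral X] [IsNoetherian X] (U : X.Opens)
    [Nonempty U] : {p : X | Order.coheight p = 1 ∧ p ∉ U}.Finite := by
  obtain ⟨S, hS, hcl, hirr, hU⟩ :=
    NoetherianSpace.exists_finite_set_isClosed_irreducible U.isOpen.isClosed_compl
  have hη : genericPoint X ∈ U :=
    ((genericPoint_spec X).mem_open_set_iff U.isOpen).mpr (by simpa using ‹Nonempty U›)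
  refine Set.Finite.of_injOn (f := fun p : X => closure {p}) (t := S) ?_ ?_ hS
  · rintro p ⟨hp, hpU⟩
    have hpS : p ∈ ⋃₀ S := hU ▸ hpU
    obtain ⟨t, ht, hpt⟩ := hpS
    obtain ⟨g, hg⟩ := QuasiSober.sober (hirr t ht) (hcl t ht)
    have hgt : g ∈ t := hg.mem
    have hgU : g ∉ U := fun h => (hU.symm.subset ⟨t, ht, hgt⟩ : g ∈ (U : Set X)ᶜ) h
    have hgp : g ⤳ p := hg.specializes hpt
    suffices h : p ⤳ g by
      have h' : closure {p} = t := (inseparable_iff_closure_eq.mp (h.antisymm hgp)).trans hg.def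
      change closure {p} ∈ S
      rwa [h']
    -- Otherwise `p < g < genericPoint X` would give `p` coheight at least two.
    by_contra hne
    have h1 : p < g := lt_of_le_not_ge hgp hne
    have h2 : g < genericPoint X :=
      lt_of_le_not_ge (genericPoint_specializes g) fun h => hgU (h.mem_open U.isOpen hη)
    have h3 := Order.coheight_add_one_le h1
    have h4 := Order.coheight_add_one_le h2
    rw [hp] at h3
    have h5 : (1 : ℕ∞) ≤ Order.coheight g := le_trans le_add_self h4
    have h6 : (1 : ℕ∞) + 1 ≤ 1 := le_trans (by gcongr) h3
    exact absurd h6 (by decide)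
  · intro p _ q _ h
    exact (inseparable_iff_closure_eq.mpr h).eq

/-- Local representatives of `f` glue, since sections over nonempty opens inject into the function
field. -/
theorem exists_section_of_forall_mem_range [IsIntegral X] {f : X.functionField}
    (hf : ∀ p : X, f ∈ (algebraMap (X.presheaf.stalk p) X.functionField).range) :
    ∃ s : Γ(X, ⊤), X.presheaf.germ ⊤ (genericPoint X) trivial s = f := by
  have h (p : X) : ∃ (U : X.Opens) (_ : p ∈ U) (s : Γ(X, U)) (h : genericPoint X ∈ U),
      X.presheaf.germ U (genericPoint X) h s = f := by
    obtain ⟨a, rfl⟩ := hf p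
    obtain ⟨U, hU, s, rfl⟩ := X.presheaf.exists_germ_eq a
    have : Nonempty U := ⟨⟨p, hU⟩⟩
    exact ⟨U, hU, s, _, (Scheme.algebraMap_germ_eq_germToFunctionField X hU s).symm⟩
  choose U hpU s hη hs using h
  obtain ⟨t, ht, -⟩ := X.sheaf.existsUnique_gluing' U ⊤ (fun p => homOfLE le_top)
    (fun p _ => Opens.mem_iSup.mpr ⟨p, hpU p⟩) s (by
      intro p q
      apply germ_injective_of_isIntegral X (genericPoint X) (U := U p ⊓ U q) ⟨hη p, hη q⟩
      exact (X.presheaf.germ_res_apply (Opens.infLELeft (U p) (U q)) _ _ (s p)).trans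
        (((hs p).trans (hs q).symm).trans
        (X.presheaf.germ_res_apply (Opens.infLERight (U p) (U q)) _ _ (s q)).symm))
  let p := genericPoint X
  refine ⟨t, ?_⟩
  rw [← hs p, ← ht p]
  exact (X.presheaf.germ_res_apply (homOfLE le_top) _ _ t).symm

theorem isIntegralElem_of_forall_mem_range [IsIntegral X] [UniversallyClosed π]
    {f : X.functionField}
    (hf : ∀ p : X, f ∈ (algebraMap (X.presheaf.stalk p) X.functionField).range) :
    (stalkHom π (genericPoint X)).IsIntegralElem f := by
  obtain ⟨s, rfl⟩ := exists_section_of_forall_mem_range hf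
  have hint : ((Scheme.ΓSpecIso (.of k)).inv ≫ π.appTop).hom.IsIntegral := by
    apply RingHom.isIntegral_respectsIso.2
      (e := (Scheme.ΓSpecIso (.of k)).symm.commRingCatIsoToRingEquiv)
    exact isIntegral_appTop_of_universallyClosed π
  have heq : Spec.preimage (X.fromSpecStalk (genericPoint X) ≫ π) =
      ((Scheme.ΓSpecIso (.of k)).inv ≫ π.appTop) ≫
        X.presheaf.germ ⊤ (genericPoint X) trivial := by
    apply Spec.map_injective
    rw [Spec.map_preimage, Spec.map_comp, Spec.map_comp, ← Scheme.fromSpecStalk_toSpecΓ,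
      Category.assoc, ← Scheme.toSpecΓ_naturality_assoc]
    simp
  obtain ⟨q, hq, hqs⟩ := hint s
  refine ⟨q, hq, ?_⟩
  have : stalkHom π (genericPoint X) =
      (X.presheaf.germ ⊤ (genericPoint X) trivial).hom.comp
        ((Scheme.ΓSpecIso (.of k)).inv ≫ π.appTop).hom := congrArg CommRingCat.Hom.hom heq
  rw [this, ← Polynomial.hom_eval₂, hqs, map_zero]

theorem algebraMap_comp_stalkHom [IsIntegral X] (p : X) :
    (algebraMap (X.presheaf.stalk p) X.functionField).comp (stalkHom π p) =
      stalkHom π (genericPoint X) :=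
  stalkSpecializes_comp_stalkHom π _

/-- On a separated scheme, a local ring which is a valuation ring dominates no other local ring. -/
theorem specializes_of_range_le [IsIntegral X] [IsSeparated π] {p q : X}
    [ValuationRing (X.presheaf.stalk q)]
    (h : (algebraMap (X.presheaf.stalk p) X.functionField).range ≤
      (algebraMap (X.presheaf.stalk q) X.functionField).range) : q ⤳ p := by
  have hinj := IsFractionRing.injective (X.presheaf.stalk q) X.functionField
  let e : X.presheaf.stalk q ≃+* (algebraMap (X.presheaf.stalk q) X.functionField).range :=
    RingEquiv.ofBijective _ (⟨fun a b hab => hinj (congrArg Subtype.val hab),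
      RingHom.rangeRestrict_surjective _⟩ :
      Function.Bijective (algebraMap (X.presheaf.stalk q) X.functionField).rangeRestrict)
  let φ : X.presheaf.stalk p →+* X.presheaf.stalk q :=
    e.symm.toRingHom.comp ((Subring.inclusion h).comp
      (algebraMap (X.presheaf.stalk p) X.functionField).rangeRestrict)
  have hφ : (algebraMap (X.presheaf.stalk q) X.functionField).comp φ =
      algebraMap (X.presheaf.stalk p) X.functionField := by
    ext a
    have : e (φ a) = Subring.inclusion h
      ((algebraMap (X.presheaf.stalk p) X.functionField).rangeRestrict a) := e.apply_symm_apply _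
    exact congrArg Subtype.val this
  have hφk : φ.comp (stalkHom π p) = stalkHom π q := by
    ext c
    apply hinj
    have h1 := RingHom.congr_fun (algebraMap_comp_stalkHom π p) c
    have h2 := RingHom.congr_fun (algebraMap_comp_stalkHom π q) c
    exact ((RingHom.congr_fun hφ _).trans h1).trans h2.symm
  have hfac (r : X) : Spec.map (CommRingCat.ofHom
      (algebraMap (X.presheaf.stalk r) X.functionField)) ≫ X.fromSpecStalk r =
        X.fromSpecStalk (genericPoint X) :=
    Scheme.SpecMap_stalkSpecializes_fromSpecStalk ((genericPoint_spec X).specializes trivial)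
  have hk (r : X) : X.fromSpecStalk r ≫ π = Spec.map (CommRingCat.ofHom (stalkHom π r)) :=
    (Spec.map_preimage _).symm
  -- The local ring at `q` is the valuation ring of the test square. It has two lifts, the canonical
  -- one and one through the local ring at `p`; by separatedness they agree, so `q` is a
  -- generization of `p`.
  let S : ValuativeCommSq π :=
    { R := X.presheaf.stalk q
      K := X.functionField
      i₁ := X.fromSpecStalk (genericPoint X)
      i₂ := Spec.map (CommRingCat.ofHom (stalkHom π q))
      commSq := ⟨by
        rw [← hk q]
        exact (congrArg (· ≫ π) (hfac q)).symm.trans (Category.assoc _ _ _)⟩ }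
  let l₁ : S.commSq.LiftStruct := ⟨X.fromSpecStalk q, hfac q, hk q⟩
  let l₂ : S.commSq.LiftStruct := ⟨Spec.map (CommRingCat.ofHom φ) ≫ X.fromSpecStalk p, by
      refine Eq.trans ?_ (hfac p)
      rw [← Category.assoc]
      congr 1
      refine (Spec.map_comp _ _).symm.trans (congrArg Spec.map ?_)
      exact congrArg CommRingCat.ofHom hφ, by
      rw [Category.assoc, hk]
      refine (Spec.map_comp _ _).symm.trans (congrArg Spec.map ?_)
      exact congrArg CommRingCat.ofHom hφk⟩
  have := IsSeparated.valuativeCriterion π S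
  have hl : X.fromSpecStalk q = Spec.map (CommRingCat.ofHom φ) ≫ X.fromSpecStalk p :=
    congrArg CommSq.LiftStruct.l (Subsingleton.elim l₁ l₂)
  have hq : q ∈ Set.range (X.fromSpecStalk p) := by
    rw [← Scheme.fromSpecStalk_closedPoint (x := q), hl]
    exact ⟨_, rfl⟩
  rwa [Scheme.range_fromSpecStalk] at hq

end Curve

/-! ### The places of the curve and the degree formula -/

section CurvePlaces

variable {k : Type u} [Field k] {X : Scheme.{u}} (π : X ⟶ Spec (CommRingCat.of k))

theorem finrank_residueField_eq_pointDegree (p : X) :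
    letI := (stalkHom π p).toAlgebra
    Module.finrank k (IsLocalRing.ResidueField (X.presheaf.stalk p)) = pointDegree π p := by
  let := (stalkHom π p).toAlgebra
  have h : (residueFieldHom π p).toAlgebra =
      (inferInstance : Algebra k (IsLocalRing.ResidueField (X.presheaf.stalk p))) := by
    apply Algebra.algebra_ext
    intro c
    exact RingHom.congr_fun (residueFieldHom_eq π p) c
  rw [pointDegree, h]
  rfl

theorem finite_residueField (p : X) (h : (residueFieldHom π p).Finite) :
    letI := (stalkHom π p).toAlgebra
    Module.Finite k (IsLocalRing.ResidueField (X.presheaf.stalk p)) := by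
  let := (stalkHom π p).toAlgebra
  rw [residueFieldHom_eq] at h
  exact RingHom.finite_algebraMap.mp h

theorem mem_range_algebraMap_stalk_of_coheight_eq_zero [IsIntegral X] (f : X.functionField)
    {p : X} (hp : Order.coheight p = 0) :
    f ∈ (algebraMap (X.presheaf.stalk p) X.functionField).range := by
  have h : p ⤳ genericPoint X := by
    by_contra hne
    have hlt : p < genericPoint X := lt_of_le_not_ge (genericPoint_specializes p) hne
    have := Order.coheight_add_one_le hlt
    rw [hp] at this
    simp at this
  obtain rfl : p = genericPoint X := (h.antisymm (genericPoint_specializes p)).eq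
  refine ⟨f, ?_⟩
  change X.presheaf.stalkSpecializes _ f = f
  rw [TopCat.Presheaf.stalkSpecializes_refl]
  rfl

theorem coheight_le_one (hX : topologicalKrullDim X = 1) (p : X) : Order.coheight p ≤ 1 := by
  have := ringKrullDim_stalk_le_topologicalKrullDim p
  rw [ringKrullDim_stalk_eq_coheight, hX] at this
  exact_mod_cast this

theorem ord_eq_neg_log [IsIntegral X] [IsLocallyNoetherian X] {f : X.functionField} (hf : f ≠ 0)
    {p : X} (hp : Order.coheight p = 1) [IsDiscreteValuationRing (X.presheaf.stalk p)] :
    Scheme.ord f p = - WithZero.log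
      ((IsDiscreteValuationRing.maximalIdeal (X.presheaf.stalk p)).valuation X.functionField f) := by
  rw [Scheme.ord_eq_iff hp hf]
  have : Ring.KrullDimLE 1 (X.presheaf.stalk p) := krullDimLE_of_coheight_le hp.le
  refine (Ring.ordFrac_eq_valuation_inv (R := X.presheaf.stalk p) f).trans ?_
  change _ = WithZero.exp _
  rw [WithZero.exp_neg, WithZero.exp_log (by simpa using hf)]

/-- `f` is a unit on some nonempty open set, which misses only finitely many points of codimension
one. -/
theorem finite_setOf_ord_ne_zero [IsIntegral X] [IsNoetherian X] {f : X.functionField}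
    (hf : f ≠ 0) : {p : X | Order.coheight p = 1 ∧ Scheme.ord f p ≠ 0}.Finite := by
  obtain ⟨U, -, f', hU, rfl, hf'⟩ := exists_isUnit_germ_eq X f hf
  exact (finite_setOf_coheight_eq_one_notMem U).subset fun p hp =>
    ⟨hp.1, fun hpU => hp.2 (Scheme.ord_of_isUnit hf' hpU)⟩

theorem finsum_pointDegree_mul_ord_eq_zero [IsIntegral X] [IsProper π] [IsRegularScheme X]
    (hX : topologicalKrullDim X = 1) {f : X.functionField} (hf : f ≠ 0) :
    ∑ᶠ p : {p : X // Order.coheight p = 1},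
      (pointDegree π p.1 : ℤ) * Scheme.ord f p.1 = 0 := by
  have : CompactSpace X := QuasiCompact.compactSpace_of_compactSpace π
  have : IsNoetherian X := { }
  let (p : X) : Algebra k (X.presheaf.stalk p) := (stalkHom π p).toAlgebra
  have hDVR (p : {p : X // Order.coheight p = 1}) :
      IsDiscreteValuationRing (X.presheaf.stalk p.1) :=
    haveI := IsRegularScheme.isRegularLocalRing_stalk p.1
    isDiscreteValuationRing_of_isRegularLocalRing _ <| by
      rw [ringKrullDim_stalk_eq_coheight, p.2]
      rfl
  have (p : X) : IsScalarTower k (X.presheaf.stalk p) X.functionField :=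
    IsScalarTower.of_algebraMap_eq' (algebraMap_comp_stalkHom π p).symm
  let P (p : {p : X // Order.coheight p = 1}) : DiscretePlace k X.functionField :=
    .ofDVR k (X.presheaf.stalk p.1) X.functionField
  have hle (p) (x : X.functionField) : (P p).v x ≤ 1 ↔
      x ∈ (algebraMap (X.presheaf.stalk p.1) X.functionField).range :=
    DiscretePlace.ofDVR_v_le_one_iff k (X.presheaf.stalk p.1) X.functionField
  have hclosed (p : {p : X // Order.coheight p = 1}) : IsClosed {p.1} :=
    isClosed_singleton_of_coheight_eq_one hX p.2
  have hfinite (p) : Module.Finite k (P p).ResidueSpace := by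
    have := finite_residueField π p.1 (residueFieldHom_finite_of_isClosed π (hclosed p))
    obtain ⟨e⟩ := DiscretePlace.nonempty_residueField_equiv k (X.presheaf.stalk p.1)
      X.functionField
    exact Module.Finite.equiv e
  have hdeg (p) : (P p).degree = pointDegree π p.1 := by
    obtain ⟨e⟩ := DiscretePlace.nonempty_residueField_equiv k (X.presheaf.stalk p.1)
      X.functionField
    exact e.finrank_eq.symm.trans (finrank_residueField_eq_pointDegree π p.1)
  have hord (p) {x : X.functionField} (hx : x ≠ 0) :
      Scheme.ord x p.1 = - WithZero.log ((P p).v x) := ord_eq_neg_log hx p.2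
  have hfin (x : X.functionField) (hx : x ≠ 0) : {p | (P p).v x ≠ 1}.Finite := by
    refine ((finite_setOf_ord_ne_zero hx).preimage Subtype.val_injective.injOn).subset
      fun p hp => ⟨p.2, fun h => hp ?_⟩
    rw [hord p hx, neg_eq_zero] at h
    rw [← WithZero.exp_log (x := (P p).v x) (by simpa using hx), h, WithZero.exp_zero]
  have hint (x : X.functionField) (hx : ∀ p, (P p).v x ≤ 1) : _root_.IsIntegral k x := by
    refine isIntegralElem_of_forall_mem_range π fun p => ?_
    rcases Order.le_one_iff.mp (coheight_le_one hX p) with hp | hp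
    · exact mem_range_algebraMap_stalk_of_coheight_eq_zero x hp
    · exact (hle ⟨p, hp⟩ x).mp (hx ⟨p, hp⟩)
  have hdist (p q) (hpq : p ≠ q) : ∃ x, (P p).v x ≤ 1 ∧ ¬ (P q).v x ≤ 1 := by
    by_contra! h
    have hs : q.1 ⤳ p.1 := specializes_of_range_le π fun x hx =>
      (hle q x).mp (h x ((hle p x).mpr hx))
    -- A closed point specializes only to itself.
    exact hpq (Subtype.ext ((hclosed q).closure_eq.subset (specializes_iff_mem_closure.mp hs)))
  have := DiscretePlace.finsum_degree_mul_log_eq_zero hfin hint hdist hf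
  rw [← neg_eq_zero, ← finsum_neg_distrib] at this
  rw [← this]
  refine finsum_congr fun p => ?_
  rw [hord p hf, hdeg, mul_neg]

end CurvePlaces

theorem mainTheorem2 {k : Type u} [Field k] {X : Scheme.{u}}
    (π : X ⟶ Spec (CommRingCat.of k)) [IsProper π] [IsRegularScheme X] [ConnectedSpace X]
    (hX : topologicalKrullDim X = 1) :
    haveI : IsIntegral X := isIntegral_of_isRegularScheme_curve π hX
    ∀ f : X.functionField, f ≠ 0 →
      (∀ p : X, Order.coheight p = 1 → (residueFieldHom π p).Finite) ∧
      {p : X | Order.coheight p = 1 ∧ Scheme.ord f p ≠ 0}.Finite ∧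
      ∑ᶠ p : {p : X // Order.coheight p = 1},
        (pointDegree π p.1 : ℤ) * Scheme.ord f p.1 = 0 := by
  intro f hf
  have := isIntegral_of_isRegularScheme_curve π hX
  have : CompactSpace X := QuasiCompact.compactSpace_of_compactSpace π
  have : IsNoetherian X := { }
  exact ⟨fun p hp => residueFieldHom_finite_of_isClosed π
    (isClosed_singleton_of_coheight_eq_one hX hp), finite_setOf_ord_ne_zero hf,
    finsum_pointDegree_mul_ord_eq_zero π hX hf⟩
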